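/- Let $(\mathcal W,\mathcal F)$ be a measurable space of arms, $\Theta\subseteq\mathbb R$ an interval, and $(p_\theta)_{\theta\in\Theta}$ a measurable family of probability distributions on $\mathbb R$ such that $p_\theta$ has mean $\theta$. Write $d(\theta_1,\theta_2)=\mathrm{KL}(p_{\theta_1},p_{\theta_2})$, and assume that $d$ is continuous on $\Theta\times\Theta$, that $0<d(\theta_1,\theta_2)<\infty$ for $\theta_1\neq\theta_2$, and that for all $\theta_1<\theta_2<\theta_3$ in $\Theta$ $$d(\theta_1,\theta_3)>d(\theta_2,\theta_3),\qquad d(\theta_1,\theta_2)<d(\theta_1,\theta_3),\qquad d(\theta_2,\theta_1)\le d(\theta_3,\theta_1).$$ An infinite bandit model $(M,\mu)$ consists of a probability measure $M$ on $\mathcal W$ and a measurable mean mapping $\mu:\mathcal W\to\Theta$ whose law under $M$ has bounded support. Put $G(x)=M(\{w:\mu(w)\le x\})$, $G^{-1}(q)=\inf\{x: G(x)\ge q\}$ and $\mu^*=G^{-1}(1)$. An algorithm chooses in each round $t=1,2,\dots$ an arm $W_t\in\mathcal W$ at random, with a conditional law given the past arms and rewards that may depend on $M$ but not on $\mu$;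 it then observes a reward $Z_t\sim p_{\mu(W_t)}$ which, given $W_t$, is independent of the past. It stops after a number $\tau\in\{1,2,\dots\}\cup\{\infty\}$ of pulls, where $\tau$ is a stopping time of the filtration generated by the arms and rewards, and when it stops it returns one of the arms pulled so far, as a function of the observed history. For $\alpha,\delta\in(0,1)$ the algorithm is $(\alpha,\delta)$-correct if, in every infinite bandit model $(M,\mu)$ on $\mathcal W$, the probability that it stops and returns an arm outside $\{w:\mu(w)\ge G^{-1}(1-\alpha)\}$ is at most $\delta$. Let $0<\alpha<\tfrac12$, $0<\delta<1$, $m=\lceil 1/\alpha\rceil$, and let $(M,\mu)$ be an infinite bandit model with $\mu(w)\le\mu^*$ for all $w\in\mathcal W$ and $\mu^*<\sup\Theta$. Define the group boundaries by $b_0=\mu^*$ and $b_i=G^{-1}(G(b_{i-1})-\alpha)$ for $i\ge1$, and assume $M(\{w:\mu(w)=b_i\})=0$ for $1\le i\le m-1$, so that each of the groups $\{w:\mu(w)\in(b_i,b_{i-1}]\}$ with $1\le i\le m-1$ has measure exactly $\alpha$. Then every $(\alpha,\delta)$-correct algorithm satisfies, in the model $(M,\mu)$, $$\mathbb E[\tau]\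 \ge\ \left(\frac1{d(\mu^*,b_2)}+\sum_{i=2}^{m-1}\frac1{d(b_i,\mu^*)}\right)\log\frac1{2.4\,\delta}.$$ -/

import Mathlib

open MeasureTheory ProbabilityTheory
open scoped ENNReal

namespace InfBandit

/-- A family of reward distributions `p θ` on `ℝ`, indexed by `θ ∈ Θ` and parameterized by its
mean. -/
structure RewardFamily (Θ : Set ℝ) where
  /-- The reward distribution with mean `θ`. -/
  law : Kernel Θ ℝ
  isMarkov : IsMarkovKernel law
  integrable_id : ∀ θ : Θ, Integrable (fun x : ℝ => x) (law θ)
  integral_id : ∀ θ : Θ, ∫ x, x ∂(law θ) = (θ : ℝ)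

attribute [instance] RewardFamily.isMarkov

/-- The Kullback-Leibler divergence `d(θ₁, θ₂)` between the reward distributions of means
`θ₁, θ₂ ∈ Θ` (a junk value is used when one of the arguments is not in `Θ`). -/
noncomputable def RewardFamily.d {Θ : Set ℝ} (p : RewardFamily Θ) (x y : ℝ) : ℝ≥0∞ :=
  open scoped Classical in
  if h : x ∈ Θ ∧ y ∈ Θ then InformationTheory.klDiv (p.law ⟨x, h.1⟩) (p.law ⟨y, h.2⟩) else ⊤

/-- Regularity of the divergence: `d` is continuous on `Θ × Θ`, positive and finite off the
diagonal, and grows when one moves one of the two arguments away from the other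
(the second argument upwards, or the first argument in either direction). -/
structure RewardFamily.Regular {Θ : Set ℝ} (p : RewardFamily Θ) : Prop where
  continuous_d : Continuous fun q : Θ × Θ => p.d q.1 q.2
  d_pos : ∀ x ∈ Θ, ∀ y ∈ Θ, x ≠ y → 0 < p.d x y
  d_lt_top : ∀ x ∈ Θ, ∀ y ∈ Θ, x ≠ y → p.d x y < ⊤
  d_left_below : ∀ x ∈ Θ, ∀ y ∈ Θ, ∀ z ∈ Θ, x < y → y < z → p.d y z < p.d x z
  d_right_above : ∀ x ∈ Θ, ∀ y ∈ Θ, ∀ z ∈ Θ, x < y → y < z → p.d x y < p.d x z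
  d_left_above : ∀ x ∈ Θ, ∀ y ∈ Θ, ∀ z ∈ Θ, x < y → y < z → p.d y x ≤ p.d z x

/-- An infinite bandit model on the set of arms `W`: an arm probability measure `M` and a
measurable mean mapping `μ : W → Θ` whose reservoir distribution has bounded support. -/
structure BanditModel (W : Type*) [MeasurableSpace W] (Θ : Set ℝ) where
  M : Measure W
  isProb : IsProbabilityMeasure M
  mean : W → Θ
  measurable_mean : Measurable mean
  bounded : ∃ a b : ℝ, ∀ᵐ w ∂M, (mean w : ℝ) ∈ Set.Icc a b

attribute [instance] BanditModel.isProb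

namespace BanditModel

variable {W : Type*} [MeasurableSpace W] {Θ : Set ℝ}

/-- The reservoir cumulative distribution function. -/
noncomputable def G (B : BanditModel W Θ) (x : ℝ) : ℝ := B.M.real {w | (B.mean w : ℝ) ≤ x}

/-- The quantile function `G⁻¹(q) = inf {θ : G(θ) ≥ q}`. -/
noncomputable def quantile (B : BanditModel W Θ) (q : ℝ) : ℝ := sInf {x : ℝ | q ≤ B.G x}

/-- The largest possible mean under the reservoir distribution, `μ* = G⁻¹(1)`. -/
noncomputable def muStar (B : BanditModel W Θ) : ℝ := B.quantile 1

/-- The group boundaries: `b₀ = μ*` and `b_{i+1} = G⁻¹(G(b_i) - α)`. -/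
noncomputable def b (B : BanditModel W Θ) (α : ℝ) : ℕ → ℝ
  | 0 => B.muStar
  | i + 1 => B.quantile (B.G (B.b α i) - α)

/-- The top-`α` fraction of the arms. -/
def good (B : BanditModel W Θ) (α : ℝ) : Set W := {w | B.quantile (1 - α) ≤ (B.mean w : ℝ)}

end BanditModel

/-- The histories of the rounds `0, …, n`: in each round, the arm pulled and the reward. -/
abbrev History (W : Type*) (n : ℕ) : Type _ := (i : Finset.Iic n) → (fun _ : ℕ => W × ℝ) i

/-- A policy. The first arm has law `init`; the arm of round `n + 1` has conditional law
`sample n h` given the history `h` of the rounds `0, …, n`. After round `n` the policy stops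
(if it did not stop before) when the history is in `halt n`, and it then returns the arm pulled in
round `recommend n h`. -/
structure Policy (W : Type*) [MeasurableSpace W] where
  init : Measure W
  isProb : IsProbabilityMeasure init
  sample : (n : ℕ) → Kernel (History W n) W
  isMarkov : ∀ n, IsMarkovKernel (sample n)
  halt : (n : ℕ) → Set (History W n)
  measurableSet_halt : ∀ n, MeasurableSet (halt n)
  recommend : (n : ℕ) → History W n → Finset.Iic n
  measurable_recommend : ∀ n, Measurable (recommend n)

attribute [instance] Policy.isProb Policy.isMarkov

namespace Policy

variable {W : Type*} [MeasurableSpace W] {Θ : Set ℝ}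

/-- Given the arm `w`, the reward is drawn from the reward distribution of mean `μ(w)`. -/
noncomputable def rewardKernel (p : RewardFamily Θ) (B : BanditModel W Θ) : Kernel W ℝ :=
  p.law.comap B.mean B.measurable_mean

instance (p : RewardFamily Θ) (B : BanditModel W Θ) : IsMarkovKernel (rewardKernel p B) := by
  unfold rewardKernel; infer_instance

/-- The joint law of the arm and the reward of round `n + 1`, given the history: the arm is drawn
by the policy, and the reward depends on the history only through that arm. -/
noncomputable def stepKernel (π : Policy W) (p : RewardFamily Θ) (B : BanditModel W Θ) (n : ℕ) :
    Kernel (History W n) (W × ℝ) :=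
  (π.sample n) ⊗ₖ ((rewardKernel p B).prodMkLeft (History W n))

instance (π : Policy W) (p : RewardFamily Θ) (B : BanditModel W Θ) (n : ℕ) :
    IsMarkovKernel (π.stepKernel p B n) := by
  unfold stepKernel; infer_instance

/-- The law of the infinite sequence of arms and rewards when the sampling rule of `π` is run in
the bandit model `B` (the rounds after stopping do not matter). -/
noncomputable def gameLaw (π : Policy W) (p : RewardFamily Θ) (B : BanditModel W Θ) :
    Measure (ℕ → W × ℝ) :=
  Kernel.trajMeasure (X := fun _ : ℕ => W × ℝ) (π.init ⊗ₘ rewardKernel p B)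
    (fun n => π.stepKernel p B n)

/-- The history of the rounds `0, …, n` along a play. -/
def hist (n : ℕ) (ω : ℕ → W × ℝ) : History W n :=
  Preorder.frestrictLe (π := fun _ : ℕ => W × ℝ) n ω

/-- `π` stops exactly after round `n`. -/
def StopsAt (π : Policy W) (n : ℕ) (ω : ℕ → W × ℝ) : Prop :=
  hist n ω ∈ π.halt n ∧ ∀ k < n, hist k ω ∉ π.halt k

/-- The number `τ` of pulls made when `π` stops (`⊤` if it never stops). -/
noncomputable def tau (π : Policy W) (ω : ℕ → W × ℝ) : ℕ∞ :=
  ⨅ (n : ℕ) (_ : hist n ω ∈ π.halt n), ((n + 1 : ℕ) : ℕ∞)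

/-- The arm that is returned when `π` stops after round `n`. -/
def returned (π : Policy W) (n : ℕ) (ω : ℕ → W × ℝ) : W :=
  (ω (π.recommend n (hist n ω))).1

/-- The expected sample complexity `E[τ]`. -/
noncomputable def expectedTau (π : Policy W) (p : RewardFamily Θ) (B : BanditModel W Θ) : ℝ≥0∞ :=
  ∫⁻ ω, (π.tau ω : ℝ≥0∞) ∂(π.gameLaw p B)

end Policy

/-- An algorithm knows the set of arms and may use the arm measure `M` in any way, but has no
access to the mean mapping, except through the rewards. -/
abbrev Algorithm (W : Type*) [MeasurableSpace W] : Type _ := Measure W → Policy W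

/-- `(α, δ)`-correctness: in every infinite bandit model on `W`, the probability that the algorithm
stops and returns an arm outside the top-`α` fraction is at most `δ`. -/
def Algorithm.IsCorrect {W : Type*} [MeasurableSpace W] {Θ : Set ℝ} (A : Algorithm W)
    (p : RewardFamily Θ) (α δ : ℝ) : Prop :=
  ∀ B : BanditModel W Θ,
    (A B.M).gameLaw p B {ω | ∃ n, (A B.M).StopsAt n ω ∧ (A B.M).returned n ω ∉ B.good α}
      ≤ ENNReal.ofReal δ

end InfBandit

/-!
The proof is a change-of-measure argument. A model `B'` that differs from `B` only by the means of a
set `S` of arms, and for which the top-`α` fractions of `B` and `B'` are disjoint, forces a correct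
algorithm to tell the two models apart: returning an arm of the top-`α` fraction of `B` has
probability at least `1 - δ` in `B` and at most `δ` in `B'`. Information on the difference is
gathered only when an arm of `S` is pulled, at most `sup_{w ∈ S} d(μ(w), μ'(w))` per pull, so that
the number of pulls of `S` has expectation at least `log (1 / (2.4 δ))` divided by that supremum
(`Policy.ofReal_log_le_mul_pulls`).

This transportation inequality is proved for the laws of the histories of the rounds `0, …, n`,
restricted to the event that round `n` takes place (`Policy.activeLaw`). By the chain rule, playing
one more round increases the divergence of these finite measures in the two models by at most the
supremum times the probability that an arm of `S` is pulled; restricting to the plays that go on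
splits off the divergence of the stopped part. The latter is bounded below by expressions linear in
the masses (`mul_sub_le_toReal_klDiv`), with slopes `± log ((1 - δ) / δ)` according to the arm
returned, and these sum up to the binary relative entropy `kl(1 - δ, δ)`. Linear bounds make it
unnecessary to know whether the algorithm stops almost surely in the model `B'`.

Two kinds of alternative models are used. The arms of the top-`α` fraction `{μ ≥ b₁}` are moved
slightly below `b₂`, which gives the term `1 / d(μ*, b₂)`. For `i ≥ 2`, the arms with mean in
`[x, b_{i-1})`, where `x < b_i`, are moved slightly above `μ*`. The choice `x = b_i` would not do,
since arms with mean exactly `μ*` would remain in the top-`α` fraction; with `x < b_i` the moved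
arms have mass more than `α`. When the expectation of `τ` is finite, the expected numbers of pulls
before stopping form a finite measure (`Policy.pulls`), so that one may let `x` increase to `b_i`,
which gives the term `1 / d(b_i, μ*)` for the arms with mean in `[b_i, b_{i-1})`. These sets of arms
and `{μ ≥ b₁}` are pairwise disjoint, so that the bounds add up to a lower bound for the total
number of pulls.
-/

/-! ### Kullback-Leibler divergence of restrictions and of kernels -/

namespace InfBandit

open InformationTheory Filter Topology

section KL

variable {X Y : Type*} {mX : MeasurableSpace X} {mY : MeasurableSpace Y}

lemma klDiv_eq_lintegral_of_withDensity {μ ν : Measure X} [IsFiniteMeasure μ] [IsFiniteMeasure ν]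
    {f : X → ℝ≥0∞} (hf : Measurable f) (h : μ = ν.withDensity f) :
    klDiv μ ν = ∫⁻ x, ENNReal.ofReal (klFun (f x).toReal) ∂ν := by
  have hac : μ ≪ ν := h ▸ withDensity_absolutelyContinuous ν f
  rw [klDiv_eq_lintegral_klFun_of_ac hac]
  refine lintegral_congr_ae ?_
  have h1 : μ.rnDeriv ν =ᵐ[ν] f := h ▸ Measure.rnDeriv_withDensity ν hf
  filter_upwards [h1] with x hx
  rw [hx]

/-- One half of the additivity of the divergence over a measurable partition into two pieces. -/
lemma klDiv_restrict_add_klDiv_restrict_compl_le (μ ν : Measure X) [IsFiniteMeasure μ]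
    [IsFiniteMeasure ν] {s : Set X} (hs : MeasurableSet s) :
    klDiv (μ.restrict s) (ν.restrict s) + klDiv (μ.restrict sᶜ) (ν.restrict sᶜ) ≤ klDiv μ ν := by
  by_cases hac : μ ≪ ν
  swap
  · simp [hac]
  have hμ : μ = ν.withDensity (μ.rnDeriv ν) := (Measure.withDensity_rnDeriv_eq μ ν hac).symm
  have key : ∀ t : Set X, MeasurableSet t →
      klDiv (μ.restrict t) (ν.restrict t)
        = ∫⁻ x in t, ENNReal.ofReal (klFun (μ.rnDeriv ν x).toReal) ∂ν := by
    intro t ht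
    refine klDiv_eq_lintegral_of_withDensity (Measure.measurable_rnDeriv μ ν) ?_
    rw [← restrict_withDensity ht, ← hμ]
  rw [key s hs, key sᶜ hs.compl, lintegral_add_compl _ hs,
    klDiv_eq_lintegral_klFun_of_ac hac]

/-- Fenchel-Young inequality for the function `klFun`. -/
lemma mul_sub_le_klFun {x : ℝ} (hx : 0 ≤ x) (t : ℝ) :
    t * x - (Real.exp t - 1) ≤ klFun x := by
  rcases hx.eq_or_lt with rfl | hx
  · simp [klFun_apply, (Real.exp_pos t).le]
  · have h := Real.add_one_le_exp (t - Real.log x)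
    rw [Real.exp_sub, Real.exp_log hx, le_div_iff₀ hx] at h
    rw [klFun_apply]
    linarith

/-- A lower bound for the divergence which is linear in the total masses: the Donsker-Varadhan
inequality for constant functions. -/
lemma mul_sub_le_toReal_klDiv {μ ν : Measure X} [IsFiniteMeasure μ] [IsFiniteMeasure ν]
    (h : klDiv μ ν ≠ ⊤) (t : ℝ) :
    t * μ.real Set.univ - (Real.exp t - 1) * ν.real Set.univ ≤ (klDiv μ ν).toReal := by
  obtain ⟨hac, hint⟩ := klDiv_ne_top_iff.1 h
  refine le_trans ?_ (mul_klFun_le_toReal_klDiv hac hint)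
  rcases (measureReal_nonneg (μ := ν) (s := Set.univ)).eq_or_lt with h0 | h0
  · have : ν Set.univ = 0 := by
      rwa [eq_comm, measureReal_eq_zero_iff] at h0
    have h2 : μ.real Set.univ = 0 := by
      rw [measureReal_eq_zero_iff]; exact hac this
    simp [h2, ← h0]
  · have h1 := mul_le_mul_of_nonneg_left
      (mul_sub_le_klFun (div_nonneg (measureReal_nonneg (μ := μ) (s := Set.univ)) h0.le) t) h0.le
    refine le_trans (le_of_eq ?_) h1
    field_simp

/-- An upper bound for the conditional divergence of two kernels with values in a countably
generated space, when the divergences of their values are bounded on a set of base points, and the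
kernels agree elsewhere. -/
lemma klDiv_compProd_right_le [MeasurableSpace.CountablyGenerated Y] (μ : Measure X)
    [IsFiniteMeasure μ] (κ η : Kernel X Y) [IsMarkovKernel κ] [IsMarkovKernel η] {S : Set X}
    (hS : MeasurableSet S) {C : ℝ≥0∞} (hC : C ≠ ⊤) (hSC : ∀ x ∈ S, klDiv (κ x) (η x) ≤ C)
    (hSc : ∀ x ∉ S, κ x = η x) :
    klDiv (μ ⊗ₘ κ) (μ ⊗ₘ η) ≤ C * μ S := by
  have hle : ∀ x, klDiv (κ x) (η x) ≤ S.indicator (fun _ => C) x := by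
    intro x
    by_cases hx : x ∈ S
    · simpa [hx] using hSC x hx
    · simp [hx, hSc x hx]
  have hac : ∀ x, κ x ≪ η x := by
    intro x
    refine (klDiv_ne_top_iff.1 (ne_top_of_le_ne_top ?_ (hle x))).1
    by_cases hx : x ∈ S <;> simp [hx, hC]
  have hκ : κ = η.withDensity (Kernel.rnDeriv κ η) := by
    ext1 x
    exact (Kernel.withDensity_rnDeriv_eq (hac x)).symm
  have hμ : μ ⊗ₘ κ = (μ ⊗ₘ η).withDensity (fun p => Kernel.rnDeriv κ η p.1 p.2) := by
    have : IsMarkovKernel (η.withDensity (Kernel.rnDeriv κ η)) := hκ ▸ inferInstance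
    conv_lhs => rw [hκ]
    exact Measure.compProd_withDensity (Kernel.measurable_rnDeriv κ η)
  rw [klDiv_eq_lintegral_of_withDensity (Kernel.measurable_rnDeriv κ η) hμ,
    Measure.lintegral_compProd (by
      have := Kernel.measurable_rnDeriv κ η
      fun_prop), ← lintegral_indicator_const hS]
  refine lintegral_mono fun x => ?_
  refine le_trans (le_of_eq ?_) (hle x)
  rw [klDiv_eq_lintegral_klFun_of_ac (hac x)]
  refine lintegral_congr_ae ?_
  filter_upwards [Kernel.rnDeriv_eq_rnDeriv_measure (κ := κ) (η := η) (a := x)] with y hy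
  rw [hy]

/-- A bound for one round: if an arm is drawn from the same kernel and then a reward is drawn given
the arm, the divergence increases only through the rewards of the arms in `S`. -/
lemma klDiv_compProd_prodMkLeft_le {H W R : Type*} [MeasurableSpace H] [MeasurableSpace W]
    [MeasurableSpace R] [MeasurableSpace.CountablyGenerated R] (μ ν : Measure H)
    [IsFiniteMeasure μ] [IsFiniteMeasure ν] (σ : Kernel H W) [IsMarkovKernel σ]
    (κ η : Kernel W R) [IsMarkovKernel κ] [IsMarkovKernel η] {S : Set W} (hS : MeasurableSet S)
    {C : ℝ≥0∞} (hC : C ≠ ⊤) (hSC : ∀ w ∈ S, klDiv (κ w) (η w) ≤ C)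
    (hSc : ∀ w ∉ S, κ w = η w) :
    klDiv (μ ⊗ₘ (σ ⊗ₖ κ.prodMkLeft H)) (ν ⊗ₘ (σ ⊗ₖ η.prodMkLeft H))
      ≤ klDiv μ ν + C * (μ ⊗ₘ (σ ⊗ₖ κ.prodMkLeft H)) {x | x.2.1 ∈ S} := by
  have hmass : (μ ⊗ₘ (σ ⊗ₖ κ.prodMkLeft H)) {x | x.2.1 ∈ S} = (μ ⊗ₘ σ) (Prod.snd ⁻¹' S) := by
    have hS' : MeasurableSet {x : H × W × R | x.2.1 ∈ S} := (measurable_fst.comp measurable_snd) hS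
    rw [← Measure.compProd_assoc', Measure.map_apply (by fun_prop) hS']
    conv_rhs => rw [← Measure.fst_compProd (μ ⊗ₘ σ) (κ.prodMkLeft H),
      Measure.fst_apply (measurable_snd hS)]
    rfl
  rw [hmass]
  calc klDiv (μ ⊗ₘ (σ ⊗ₖ κ.prodMkLeft H)) (ν ⊗ₘ (σ ⊗ₖ η.prodMkLeft H))
      ≤ klDiv (μ ⊗ₘ σ ⊗ₘ κ.prodMkLeft H) (ν ⊗ₘ σ ⊗ₘ η.prodMkLeft H) := by
        rw [← Measure.compProd_assoc', ← Measure.compProd_assoc']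
        exact klDiv_map_le _ _ (by fun_prop)
    _ = klDiv μ ν + klDiv (μ ⊗ₘ σ ⊗ₘ κ.prodMkLeft H) (μ ⊗ₘ σ ⊗ₘ η.prodMkLeft H) := by
        rw [klDiv_compProd_eq_add, klDiv_compProd_left]
    _ ≤ _ := by
        gcongr
        exact klDiv_compProd_right_le _ _ _ (measurable_snd hS) hC
          (fun x hx => by simpa using hSC x.2 hx) (fun x hx => by simpa using hSc x.2 hx)

/-- The numerical lower bound `kl(1 - δ, δ) ≥ log (1 / (2.4 δ))` for the binary relative entropy. -/
lemma log_one_div_le_binary_kl {δ : ℝ} (h0 : 0 < δ) (h1 : δ < 5 / 12) :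
    Real.log (1 / (2.4 * δ)) ≤ (1 - 2 * δ) * Real.log ((1 - δ) / δ) := by
  -- The function `2 δ log δ + (1 - 2 δ) log (1 - δ)` is convex, with minimum near `δ = 8 / 25`; it
  -- is compared with its tangent at that point, which lies above `- log 2.4` on `[0, 5 / 12]`.
  have hδ : 0 < 1 - δ := by linarith
  set c : ℝ := 8 / 25 with hc
  set e : ℝ := 17 / 25 with he
  have A : ∀ x y : ℝ, 0 < x → 0 < y → x * Real.log y + x - y ≤ x * Real.log x := by
    intro x y hx hy
    have := Real.log_le_sub_one_of_pos (div_pos hy hx)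
    rw [Real.log_div hy.ne' hx.ne'] at this
    have h2 := mul_le_mul_of_nonneg_left this hx.le
    have h3 : x * (y / x - 1) = y - x := by field_simp
    linarith
  have A1 := A δ c h0 (by norm_num [hc])
  have A2 := A (1 - δ) e hδ (by norm_num [he])
  have A3 : Real.log (1 - δ) ≤ Real.log e + (1 - δ - e) / e := by
    have h2 := Real.log_le_sub_one_of_pos (div_pos hδ (show (0:ℝ) < e by norm_num [he]))
    rw [Real.log_div hδ.ne' (by norm_num [he])] at h2
    have h3 : (1 - δ) / e - 1 = (1 - δ - e) / e := by rw [he]; ring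
    linarith
  -- the tangent at the two endpoints
  have E0 : 0 ≤ Real.log e - c / e + Real.log 2.4 := by
    have h2 : Real.log e + Real.log 2.4 = Real.log (e * 2.4) :=
      (Real.log_mul (by norm_num [he]) (by norm_num)).symm
    have h3 : c / e ≤ Real.log (e * 2.4) := by
      rw [Real.le_log_iff_exp_le (by norm_num [he])]
      refine (Real.exp_bound' (n := 4) (by norm_num [hc, he]) (by norm_num [hc, he])
        (by norm_num)).trans ?_
      norm_num [Finset.sum_range_succ, hc, he, Nat.factorial]
    linarith
  have E1 : 0 ≤ 5 / 6 * Real.log c + 1 / 6 * Real.log e + (5 / 12 - c) / e + Real.log 2.4 := by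
    have h2 : 5 * Real.log c + Real.log e + 6 * Real.log 2.4
        = Real.log (c ^ 5 * e * 2.4 ^ 6) := by
      rw [Real.log_mul (by norm_num [hc, he]) (by norm_num),
        Real.log_mul (by norm_num [hc]) (by norm_num [he]), Real.log_pow, Real.log_pow]
      norm_num
    have h3 : -(6 * ((5 / 12 - c) / e)) ≤ Real.log (c ^ 5 * e * 2.4 ^ 6) := by
      rw [Real.le_log_iff_exp_le (by norm_num [hc, he]), Real.exp_neg]
      refine inv_le_of_inv_le₀ (by norm_num [hc, he]) (le_trans ?_
        (Real.sum_le_exp_of_nonneg (by norm_num [hc, he]) 5))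
      norm_num [Finset.sum_range_succ, hc, he, Nat.factorial]
    linarith
  have E : 0 ≤ 2 * δ * Real.log c + (1 - 2 * δ) * Real.log e + (δ - c) / e + Real.log 2.4 := by
    have h2 := mul_nonneg (show (0 : ℝ) ≤ 1 - 12 / 5 * δ by linarith) E0
    have h3 := mul_nonneg (show (0 : ℝ) ≤ 12 / 5 * δ by linarith) E1
    have h4 : (δ - c) / e = (1 - 12 / 5 * δ) * (- (c / e)) + 12 / 5 * δ * ((5 / 12 - c) / e) := by
      field_simp
      ring
    rw [h4]
    linarith
  rw [Real.log_div hδ.ne' h0.ne', one_div, Real.log_inv, Real.log_mul (by norm_num) h0.ne']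
  have h5 : (1 - δ - e) / e = - ((δ - c) / e) := by
    rw [hc, he]; ring
  rw [h5] at A3
  have h6 : c + e = 1 := by norm_num [hc, he]
  linarith

end KL

end InfBandit

/-! ### Change of measure for a stopped game -/

namespace InfBandit

open InformationTheory Filter Topology

section Stopping

variable {X : Type*} {mX : MeasurableSpace X}

/-- The contribution of one stopping event `H` to the divergence: the divergence of two laws
dominates the divergence of their restrictions to `Hᶜ`, plus lower bounds, linear in the masses, for
the two pieces `H ∩ E` and `H \ E`. -/
lemma linear_add_klDiv_restrict_compl_le {μ ν : Measure X} [IsFiniteMeasure μ] [IsFiniteMeasure ν]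
    (h : klDiv μ ν ≠ ⊤) {H E : Set X} (hH : MeasurableSet H) (hE : MeasurableSet E) (t : ℝ) :
    klDiv (μ.restrict Hᶜ) (ν.restrict Hᶜ) ≠ ⊤ ∧
    (t * μ.real (H ∩ E) - (Real.exp t - 1) * ν.real (H ∩ E))
      + (-t * μ.real (H ∩ Eᶜ) - (Real.exp (-t) - 1) * ν.real (H ∩ Eᶜ))
      + (klDiv (μ.restrict Hᶜ) (ν.restrict Hᶜ)).toReal ≤ (klDiv μ ν).toReal := by
  have h1 := klDiv_restrict_add_klDiv_restrict_compl_le μ ν hH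
  have h2 := klDiv_restrict_add_klDiv_restrict_compl_le (μ.restrict H) (ν.restrict H) hE
  rw [Measure.restrict_restrict hE, Measure.restrict_restrict hE,
    Measure.restrict_restrict hE.compl, Measure.restrict_restrict hE.compl,
    Set.inter_comm E H, Set.inter_comm Eᶜ H] at h2
  have h3 := (add_le_add_left h2 (klDiv (μ.restrict Hᶜ) (ν.restrict Hᶜ))).trans h1
  obtain ⟨f12, f3⟩ := ENNReal.add_ne_top.1 (ne_top_of_le_ne_top h h3)
  obtain ⟨f1, f2⟩ := ENNReal.add_ne_top.1 f12
  refine ⟨f3, ?_⟩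
  have h4 := ENNReal.toReal_mono h h3
  rw [ENNReal.toReal_add f12 f3, ENNReal.toReal_add f1 f2] at h4
  have g1 := mul_sub_le_toReal_klDiv f1 t
  have g2 := mul_sub_le_toReal_klDiv f2 (-t)
  simp only [measureReal_restrict_apply_univ] at g1 g2
  linarith

lemma restrict_compProd {Y : Type*} [MeasurableSpace Y] (μ : Measure X) [SFinite μ]
    (κ : Kernel X Y) [IsSFiniteKernel κ] {s : Set X} (hs : MeasurableSet s) :
    μ.restrict s ⊗ₘ κ = (μ ⊗ₘ κ).restrict (Prod.fst ⁻¹' s) := by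
  ext t ht
  rw [Measure.restrict_apply ht, Measure.compProd_apply ht,
    Measure.compProd_apply (ht.inter (measurable_fst hs)), ← lintegral_indicator hs]
  refine lintegral_congr fun x => ?_
  have : Prod.mk x ⁻¹' (t ∩ Prod.fst ⁻¹' s) = {y | (x, y) ∈ t ∧ x ∈ s} := rfl
  rw [this]
  by_cases hx : x ∈ s
  · simp only [hx, Set.indicator_of_mem, and_true]; rfl
  · simp [hx]

end Stopping

namespace Policy

/-- The history obtained by appending one round. -/
def extend {W : Type*} (n : ℕ) (x : History W n × (W × ℝ)) : History W (n + 1) := fun i =>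
  if h : (i : ℕ) ≤ n then x.1 ⟨i, Finset.mem_Iic.2 h⟩ else x.2

lemma hist_succ {W : Type*} (n : ℕ) (ω : ℕ → W × ℝ) :
    hist (n + 1) ω = extend n (hist n ω, ω (n + 1)) := by
  funext i
  unfold extend
  by_cases h : (i : ℕ) ≤ n
  · simp [h, hist]
  · have h2 : (i : ℕ) = n + 1 := le_antisymm (Finset.mem_Iic.1 i.2) (by omega)
    simp only [h, dite_false]
    simp [hist, h2]

variable {W : Type*} [MeasurableSpace W] {Θ : Set ℝ} (π : Policy W) (p : RewardFamily Θ)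
  (B : BanditModel W Θ)

instance : IsProbabilityMeasure (π.gameLaw p B) := by
  unfold gameLaw; infer_instance

@[fun_prop]
lemma measurable_hist (n : ℕ) : Measurable (hist (W := W) n) := Preorder.measurable_frestrictLe n

lemma measurable_extend (n : ℕ) : Measurable (extend (W := W) n) := by
  refine measurable_pi_iff.2 fun i => ?_
  unfold extend
  by_cases h : (i : ℕ) ≤ n
  · simp only [h, dite_true]
    fun_prop
  · simp only [h, dite_false]
    fun_prop

/-- The histories of the rounds `0, …, n` after which `π` has not stopped. -/
def running (n : ℕ) : Set (History W n) :=
  {h | ∀ (k : ℕ) (hk : k ≤ n), (fun i : Finset.Iic k =>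
    h ⟨i, Finset.mem_Iic.2 ((Finset.mem_Iic.1 i.2).trans hk)⟩) ∉ π.halt k}

lemma measurableSet_running (n : ℕ) : MeasurableSet (π.running n) := by
  have : π.running n = ⋂ (k : ℕ) (hk : k ≤ n), ((fun (h : History W n) (i : Finset.Iic k) =>
    h ⟨i, Finset.mem_Iic.2 ((Finset.mem_Iic.1 i.2).trans hk)⟩) ⁻¹' (π.halt k))ᶜ := by
    ext h; simp [running]
  rw [this]
  refine MeasurableSet.iInter fun k => MeasurableSet.iInter fun hk => MeasurableSet.compl ?_
  refine measurableSet_preimage ?_ (π.measurableSet_halt k)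
  exact measurable_pi_iff.2 fun i => by fun_prop

/-- The plays for which round `n` takes place, that is, `τ ≥ n + 1`. -/
def active (n : ℕ) : Set (ℕ → W × ℝ) := {ω | ∀ k < n, hist k ω ∉ π.halt k}

lemma active_zero : π.active 0 = Set.univ := by simp [active]

lemma active_succ (n : ℕ) : π.active (n + 1) = π.active n ∩ hist n ⁻¹' (π.halt n)ᶜ := by
  ext ω
  simp only [active, Set.mem_ofPred_eq, Set.mem_inter_iff, Set.mem_preimage, Set.mem_compl_iff]
  constructor
  · exact fun h => ⟨fun k hk => h k (by omega), h n (by omega)⟩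
  · rintro ⟨h1, h2⟩ k hk
    rcases Nat.lt_succ_iff_lt_or_eq.1 hk with hk | rfl
    exacts [h1 k hk, h2]

lemma active_succ_eq_preimage (n : ℕ) : π.active (n + 1) = hist n ⁻¹' π.running n := by
  ext ω
  simp only [active, running, Set.mem_ofPred_eq, Set.mem_preimage, Nat.lt_succ_iff]
  rfl

lemma measurableSet_active (n : ℕ) : MeasurableSet (π.active n) := by
  cases n with
  | zero => simp [active_zero]
  | succ n =>
    rw [active_succ_eq_preimage]
    exact measurable_hist n (π.measurableSet_running n)

/-- The histories of the rounds `0, …, n` for which the arm to be returned lies in `R`. -/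
def recommending (R : Set W) (n : ℕ) : Set (History W n) := {h | (h (π.recommend n h)).1 ∈ R}

lemma measurableSet_recommending {R : Set W} (hR : MeasurableSet R) (n : ℕ) :
    MeasurableSet (π.recommending R n) := by
  have h1 : Measurable fun q : History W n × Finset.Iic n => q.1 q.2 :=
    measurable_from_prod_countable_left fun i => by fun_prop
  have h2 : Measurable fun h : History W n => (h (π.recommend n h)).1 :=
    (h1.comp (measurable_id.prodMk (π.measurable_recommend n))).fst
  exact h2 hR

lemma recommending_compl (R : Set W) (n : ℕ) :
    π.recommending Rᶜ n = (π.recommending R n)ᶜ := rfl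

/-- The plays for which `π` stops after round `n` and returns an arm of `R`. -/
def stopReturning (R : Set W) (n : ℕ) : Set (ℕ → W × ℝ) :=
  {ω | π.StopsAt n ω ∧ π.returned n ω ∈ R}

lemma stopReturning_eq (R : Set W) (n : ℕ) :
    π.stopReturning R n = hist n ⁻¹' (π.halt n ∩ π.recommending R n) ∩ π.active n := by
  ext ω
  simp only [stopReturning, StopsAt, active, Set.mem_ofPred_eq, Set.mem_inter_iff, Set.mem_preimage]
  have : π.returned n ω ∈ R ↔ hist n ω ∈ π.recommending R n := Iff.rfl
  rw [this]
  tauto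

lemma measurableSet_stopReturning {R : Set W} (hR : MeasurableSet R) (n : ℕ) :
    MeasurableSet (π.stopReturning R n) := by
  rw [stopReturning_eq]
  exact ((measurable_hist n) ((π.measurableSet_halt n).inter
    (π.measurableSet_recommending hR n))).inter (π.measurableSet_active n)

lemma StopsAt.unique {π : Policy W} {m n : ℕ} {ω : ℕ → W × ℝ} (hm : π.StopsAt m ω)
    (hn : π.StopsAt n ω) : m = n := by
  rcases lt_trichotomy m n with h | h | h
  · exact absurd hm.1 (hn.2 m h)
  · exact h
  · exact absurd hn.1 (hm.2 n h)

lemma sum_measureReal_stopReturning_le (μ : Measure (ℕ → W × ℝ)) [IsFiniteMeasure μ] {R : Set W}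
    (hR : MeasurableSet R) {δ : ℝ} (hδ : 0 ≤ δ)
    (h : μ {ω | ∃ n, π.StopsAt n ω ∧ π.returned n ω ∈ R} ≤ ENNReal.ofReal δ) (N : ℕ) :
    ∑ n ∈ Finset.range N, μ.real (π.stopReturning R n) ≤ δ := by
  rw [← measureReal_biUnion_finset]
  · refine ENNReal.toReal_le_of_le_ofReal hδ ((measure_mono ?_).trans h)
    intro ω hω
    simp only [Set.mem_iUnion] at hω
    obtain ⟨n, -, hn⟩ := hω
    exact ⟨n, hn⟩
  · intro m _ n _ hmn
    refine Set.disjoint_left.2 fun ω hm hn => hmn ?_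
    exact hm.1.unique hn.1
  · exact fun n _ => π.measurableSet_stopReturning hR n

/-- A round that is played is either followed by the next round, or stopped at with a return inside
or outside `R`. -/
lemma measureReal_active_eq (μ : Measure (ℕ → W × ℝ)) [IsFiniteMeasure μ] {R : Set W}
    (hR : MeasurableSet R) (n : ℕ) :
    μ.real (π.active n) = μ.real (π.stopReturning R n) + μ.real (π.stopReturning Rᶜ n)
      + μ.real (π.active (n + 1)) := by
  have h1 := measureReal_inter_add_sdiff (μ := μ) (s := π.active n)
    ((measurable_hist n) (π.measurableSet_halt n))
  have h2 := measureReal_inter_add_sdiff (μ := μ) (s := π.active n ∩ hist n ⁻¹' π.halt n)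
    ((measurable_hist n) (π.measurableSet_recommending hR n))
  have e1 : π.active n \ hist n ⁻¹' π.halt n = π.active (n + 1) := by
    rw [active_succ]; rfl
  have e2 : π.active n ∩ hist n ⁻¹' π.halt n ∩ hist n ⁻¹' π.recommending R n
      = π.stopReturning R n := by
    rw [stopReturning_eq]; ext ω; simp only [Set.mem_inter_iff, Set.mem_preimage]; tauto
  have e3 : (π.active n ∩ hist n ⁻¹' π.halt n) \ (hist n ⁻¹' π.recommending R n)
      = π.stopReturning Rᶜ n := by
    rw [stopReturning_eq, recommending_compl]; ext ω
    simp only [Set.mem_inter_iff, Set.mem_preimage, Set.mem_sdiff, Set.mem_compl_iff]; tauto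
  rw [e1] at h1
  rw [e2, e3] at h2
  linarith

lemma sum_stopReturning_add_active (μ : Measure (ℕ → W × ℝ)) [IsProbabilityMeasure μ] {R : Set W}
    (hR : MeasurableSet R) (N : ℕ) :
    ∑ n ∈ Finset.range N, μ.real (π.stopReturning R n)
      + ∑ n ∈ Finset.range N, μ.real (π.stopReturning Rᶜ n) + μ.real (π.active N) = 1 := by
  induction N with
  | zero => simp [active_zero]
  | succ N ih =>
    rw [π.measureReal_active_eq μ hR N] at ih
    rw [Finset.sum_range_succ, Finset.sum_range_succ]
    linarith

/-- The law of the history of the rounds `0, …, n`, on the event that round `n` takes place. -/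
noncomputable def activeLaw (n : ℕ) : Measure (History W n) :=
  ((π.gameLaw p B).restrict (π.active n)).map (hist n)

instance (n : ℕ) : IsFiniteMeasure (π.activeLaw p B n) := by
  unfold activeLaw; infer_instance

lemma activeLaw_real (n : ℕ) {s : Set (History W n)} (hs : MeasurableSet s) :
    (π.activeLaw p B n).real s = (π.gameLaw p B).real (hist n ⁻¹' s ∩ π.active n) := by
  rw [activeLaw, map_measureReal_apply (measurable_hist n) hs,
    measureReal_restrict_apply (measurable_hist n hs)]

lemma activeLaw_restrict_halt_compl (n : ℕ) :
    (π.activeLaw p B n).restrict (π.halt n)ᶜ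
      = ((π.gameLaw p B).restrict (π.active (n + 1))).map (hist n) := by
  rw [activeLaw, Measure.restrict_map (measurable_hist n) (π.measurableSet_halt n).compl,
    Measure.restrict_restrict (measurable_hist n (π.measurableSet_halt n).compl), active_succ,
    Set.inter_comm]

lemma map_hist_next (n : ℕ) {U : Set (History W n)} (hU : MeasurableSet U) :
    ((π.gameLaw p B).restrict (hist n ⁻¹' U)).map (fun ω => (hist n ω, ω (n + 1)))
      = ((π.gameLaw p B).restrict (hist n ⁻¹' U)).map (hist n) ⊗ₘ π.stepKernel p B n := by
  have hm : Measurable fun ω : ℕ → W × ℝ => (hist n ω, ω (n + 1)) := by fun_prop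
  have h : (π.gameLaw p B).map (hist n) ⊗ₘ π.stepKernel p B n
      = (π.gameLaw p B).map (fun ω => (hist n ω, ω (n + 1))) :=
    Kernel.map_frestrictLe_trajMeasure_compProd_eq_map_trajMeasure
  rw [← Measure.restrict_map (measurable_hist n) hU, restrict_compProd _ _ hU, h,
    Measure.restrict_map hm (measurable_fst hU)]
  rfl

lemma activeLaw_zero : π.activeLaw p B 0
    = (π.init ⊗ₘ rewardKernel p B).map
      (MeasurableEquiv.piUnique (fun _ : Finset.Iic 0 => W × ℝ)).symm := by
  rw [activeLaw, active_zero, Measure.restrict_univ, gameLaw, Kernel.trajMeasure]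
  have : (hist 0 : (ℕ → W × ℝ) → History W 0) = Preorder.frestrictLe 0 := rfl
  rw [this, Measure.map_comp _ _ (by fun_prop), Kernel.traj_map_frestrictLe,
    Kernel.partialTraj_self, Measure.id_comp]

lemma activeLaw_succ (n : ℕ) : π.activeLaw p B (n + 1)
    = ((π.activeLaw p B n).restrict (π.halt n)ᶜ ⊗ₘ π.stepKernel p B n).map (extend n) := by
  have : hist (n + 1) = extend n ∘ (fun ω : ℕ → W × ℝ => (hist n ω, ω (n + 1))) := by
    funext ω; exact hist_succ n ω
  rw [activeLaw_restrict_halt_compl, active_succ_eq_preimage,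
    ← map_hist_next π p B n (π.measurableSet_running n), activeLaw, active_succ_eq_preimage, this,
    Measure.map_map (measurable_extend n) (by fun_prop)]

/-- The expected number of pulls, before stopping, of the arms of a given set. -/
noncomputable def pulls : Measure W :=
  Measure.sum fun n => ((π.gameLaw p B).restrict (π.active n)).map (fun ω => (ω n).1)

lemma pulls_apply {S : Set W} (hS : MeasurableSet S) :
    π.pulls p B S = ∑' n, π.gameLaw p B ((fun ω => (ω n).1) ⁻¹' S ∩ π.active n) := by
  rw [pulls, Measure.sum_apply _ hS]
  refine tsum_congr fun n => ?_
  rw [Measure.map_apply (by fun_prop) hS, Measure.restrict_apply]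
  exact (show Measurable fun ω : ℕ → W × ℝ => (ω n).1 by fun_prop) hS

lemma tsum_indicator_active_le_tau (ω : ℕ → W × ℝ) :
    ∑' n, (π.active n).indicator (fun _ => (1 : ℝ≥0∞)) ω ≤ (π.tau ω : ℝ≥0∞) := by
  classical
  by_cases h : ∃ n, hist n ω ∈ π.halt n
  · have h1 : ((Nat.find h + 1 : ℕ) : ℕ∞) ≤ π.tau ω := by
      refine le_iInf₂ fun n hn => ?_
      exact_mod_cast Nat.succ_le_succ (Nat.find_min' h hn)
    refine le_trans ?_ (ENat.toENNReal_le.2 h1)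
    rw [tsum_eq_sum (s := Finset.range (Nat.find h + 1))]
    · refine (Finset.sum_le_card_nsmul _ _ 1 fun n _ => Set.indicator_le_self' (by simp) ω).trans ?_
      simp
    · intro n hn
      refine Set.indicator_of_notMem (fun hω => ?_) _
      exact hω (Nat.find h) (by simpa using hn) (Nat.find_spec h)
  · have : π.tau ω = ⊤ := by
      push Not at h
      simp [tau, h]
    simp [this]

lemma pulls_univ_le : π.pulls p B Set.univ ≤ π.expectedTau p B := by
  rw [pulls_apply _ _ _ MeasurableSet.univ, expectedTau]
  refine le_trans (le_of_eq ?_) (lintegral_mono fun ω => π.tsum_indicator_active_le_tau ω)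
  rw [lintegral_tsum fun n => (measurable_const.indicator (π.measurableSet_active n)).aemeasurable]
  refine tsum_congr fun n => ?_
  rw [lintegral_indicator_const (π.measurableSet_active n)]
  simp

lemma tendsto_active (h : π.pulls p B Set.univ ≠ ⊤) :
    Tendsto (fun n => (π.gameLaw p B).real (π.active n)) atTop (𝓝 0) := by
  rw [pulls_apply _ _ _ MeasurableSet.univ] at h
  have h1 := ENNReal.tendsto_atTop_zero_of_tsum_ne_top h
  simp only [Set.preimage_univ, Set.univ_inter] at h1
  exact (ENNReal.tendsto_toReal ENNReal.zero_ne_top).comp h1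

section ChangeOfMeasure

variable {B} {B' : BanditModel W Θ} {S : Set W} {C : ℝ≥0∞}

lemma klDiv_activeLaw_zero_le (hS : MeasurableSet S) (hC : C ≠ ⊤)
    (hSC : ∀ w ∈ S, klDiv (rewardKernel p B w) (rewardKernel p B' w) ≤ C)
    (hSc : ∀ w ∉ S, rewardKernel p B w = rewardKernel p B' w) :
    klDiv (π.activeLaw p B 0) (π.activeLaw p B' 0)
      ≤ C * π.gameLaw p B ((fun ω => (ω 0).1) ⁻¹' S ∩ π.active 0) := by
  have hm : Measurable fun ω : ℕ → W × ℝ => (ω 0).1 := by fun_prop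
  have hm0 : Measurable fun h : History W 0 => (h ⟨0, by simp⟩).1 := by fun_prop
  have hmass : π.gameLaw p B ((fun ω => (ω 0).1) ⁻¹' S ∩ π.active 0) = π.init S := by
    have h1 : π.gameLaw p B ((fun ω => (ω 0).1) ⁻¹' S ∩ π.active 0)
        = π.activeLaw p B 0 ((fun h : History W 0 => (h ⟨0, by simp⟩).1) ⁻¹' S) := by
      rw [activeLaw, Measure.map_apply (by fun_prop) (hm0 hS),
        Measure.restrict_apply (measurable_hist 0 (hm0 hS))]
      rfl
    rw [h1, activeLaw_zero, Measure.map_apply (by fun_prop) (hm0 hS)]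
    conv_rhs => rw [← Measure.fst_compProd π.init (rewardKernel p B), Measure.fst_apply hS]
    rfl
  rw [hmass, activeLaw_zero, activeLaw_zero]
  exact (klDiv_map_le _ _ (by fun_prop)).trans
    (klDiv_compProd_right_le _ _ _ hS hC hSC hSc)

lemma klDiv_activeLaw_succ_le (hS : MeasurableSet S) (hC : C ≠ ⊤)
    (hSC : ∀ w ∈ S, klDiv (rewardKernel p B w) (rewardKernel p B' w) ≤ C)
    (hSc : ∀ w ∉ S, rewardKernel p B w = rewardKernel p B' w) (n : ℕ) :
    klDiv (π.activeLaw p B (n + 1)) (π.activeLaw p B' (n + 1))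
      ≤ klDiv ((π.activeLaw p B n).restrict (π.halt n)ᶜ)
          ((π.activeLaw p B' n).restrict (π.halt n)ᶜ)
        + C * π.gameLaw p B ((fun ω => (ω (n + 1)).1) ⁻¹' S ∩ π.active (n + 1)) := by
  have hmass : π.gameLaw p B ((fun ω => (ω (n + 1)).1) ⁻¹' S ∩ π.active (n + 1))
      = ((π.activeLaw p B n).restrict (π.halt n)ᶜ ⊗ₘ π.stepKernel p B n) {x | x.2.1 ∈ S} := by
    have hS' : MeasurableSet {x : History W n × (W × ℝ) | x.2.1 ∈ S} :=
      (measurable_fst.comp measurable_snd) hS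
    rw [activeLaw_restrict_halt_compl, active_succ_eq_preimage,
      ← map_hist_next π p B n (π.measurableSet_running n), Measure.map_apply (by fun_prop) hS',
      Measure.restrict_apply]
    · rfl
    · exact (show Measurable fun ω : ℕ → W × ℝ => (hist n ω, ω (n + 1)) by fun_prop) hS'
  rw [hmass, activeLaw_succ, activeLaw_succ]
  exact (klDiv_map_le _ _ (measurable_extend n)).trans
    (klDiv_compProd_prodMkLeft_le _ _ _ _ _ hS hC hSC hSc)

/-- The sum, over the rounds, of the contributions of the stopping events to the divergence is at
most the divergence created by the rewards of the arms pulled in `S`. -/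
lemma sum_linear_add_klDiv_le (hS : MeasurableSet S) (hC : C ≠ ⊤)
    (hSC : ∀ w ∈ S, klDiv (rewardKernel p B w) (rewardKernel p B' w) ≤ C)
    (hSc : ∀ w ∉ S, rewardKernel p B w = rewardKernel p B' w) {R : Set W} (hR : MeasurableSet R)
    (t : ℝ) (N : ℕ) :
    klDiv (π.activeLaw p B N) (π.activeLaw p B' N) ≠ ⊤ ∧
    ∑ n ∈ Finset.range N,
      ((t * (π.gameLaw p B).real (π.stopReturning R n)
          - (Real.exp t - 1) * (π.gameLaw p B').real (π.stopReturning R n))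
        + (-t * (π.gameLaw p B).real (π.stopReturning Rᶜ n)
          - (Real.exp (-t) - 1) * (π.gameLaw p B').real (π.stopReturning Rᶜ n)))
      + (klDiv (π.activeLaw p B N) (π.activeLaw p B' N)).toReal
      ≤ ∑ n ∈ Finset.range (N + 1),
        (C * π.gameLaw p B ((fun ω => (ω n).1) ⁻¹' S ∩ π.active n)).toReal := by
  have hfin : ∀ n, C * π.gameLaw p B ((fun ω => (ω n).1) ⁻¹' S ∩ π.active n) ≠ ⊤ :=
    fun n => ENNReal.mul_ne_top hC (measure_ne_top _ _)
  induction N with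
  | zero =>
    have h := π.klDiv_activeLaw_zero_le p hS hC hSC hSc
    refine ⟨ne_top_of_le_ne_top (hfin 0) h, ?_⟩
    simpa using ENNReal.toReal_mono (hfin 0) h
  | succ N ih =>
    obtain ⟨ihtop, ih⟩ := ih
    obtain ⟨ktop, k⟩ := linear_add_klDiv_restrict_compl_le ihtop (π.measurableSet_halt N)
      (π.measurableSet_recommending hR N) t
    have e : ∀ (A : BanditModel W Θ) (R : Set W), MeasurableSet R →
        (π.activeLaw p A N).real (π.halt N ∩ π.recommending R N)
          = (π.gameLaw p A).real (π.stopReturning R N) := by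
      intro A R hR
      rw [activeLaw_real _ _ _ _
        ((π.measurableSet_halt N).inter (π.measurableSet_recommending hR N)), stopReturning_eq]
    rw [← recommending_compl, e B R hR, e B Rᶜ hR.compl, e B' R hR, e B' Rᶜ hR.compl] at k
    have h := π.klDiv_activeLaw_succ_le p hS hC hSC hSc N
    have htop := ENNReal.add_ne_top.2 ⟨ktop, hfin (N + 1)⟩
    refine ⟨ne_top_of_le_ne_top htop h, ?_⟩
    have h' := ENNReal.toReal_mono htop h
    rw [ENNReal.toReal_add ktop (hfin _)] at h'
    rw [Finset.sum_range_succ, Finset.sum_range_succ _ (N + 1)]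
    linarith

/-- The transportation inequality. If the models `B` and `B'` differ only by the means of the arms
of `S`, and if returning an arm of `R` has probability at least `1 - δ` in the model `B` (when the
policy stops almost surely) and at most `δ` in the model `B'`, then the arms of `S` must be pulled
often in the model `B`. -/
lemma ofReal_log_le_mul_pulls (hS : MeasurableSet S) (hC : C ≠ ⊤)
    (hSC : ∀ w ∈ S, klDiv (rewardKernel p B w) (rewardKernel p B' w) ≤ C)
    (hSc : ∀ w ∉ S, rewardKernel p B w = rewardKernel p B' w) {R : Set W} (hR : MeasurableSet R)
    {δ : ℝ} (h0 : 0 < δ) (h1 : δ < 5 / 12)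
    (hB : π.gameLaw p B {ω | ∃ n, π.StopsAt n ω ∧ π.returned n ω ∈ Rᶜ} ≤ ENNReal.ofReal δ)
    (hB' : π.gameLaw p B' {ω | ∃ n, π.StopsAt n ω ∧ π.returned n ω ∈ R} ≤ ENNReal.ofReal δ)
    (hfin : π.pulls p B Set.univ ≠ ⊤) :
    ENNReal.ofReal (Real.log (1 / (2.4 * δ))) ≤ C * π.pulls p B S := by
  have hSfin : π.pulls p B S ≠ ⊤ := ne_top_of_le_ne_top hfin (measure_mono (Set.subset_univ S))
  have hδ : 0 < 1 - δ := by linarith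
  have hq : 0 < (1 - δ) / δ := div_pos hδ h0
  set t : ℝ := Real.log ((1 - δ) / δ) with ht
  have ht0 : 0 ≤ t := Real.log_nonneg (by rw [le_div_iff₀ h0]; linarith)
  have het : Real.exp t - 1 = (1 - 2 * δ) / δ := by
    rw [ht, Real.exp_log hq]; field_simp; ring
  have hent : Real.exp (-t) - 1 = - ((1 - 2 * δ) / (1 - δ)) := by
    rw [ht, Real.exp_neg, Real.exp_log hq, inv_div]; field_simp; ring
  -- the inequality at a finite horizon
  have key : ∀ N, t * (1 - 2 * δ - 2 * (π.gameLaw p B).real (π.active N))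
      ≤ (C * π.pulls p B S).toReal := by
    intro N
    obtain ⟨ktop, k⟩ := π.sum_linear_add_klDiv_le p hS hC hSC hSc hR t N
    have hlast := mul_sub_le_toReal_klDiv ktop (-t)
    rw [activeLaw_real _ _ _ _ MeasurableSet.univ, activeLaw_real _ _ _ _ MeasurableSet.univ,
      Set.preimage_univ, Set.univ_inter] at hlast
    have hsum : ∑ n ∈ Finset.range (N + 1),
        (C * π.gameLaw p B ((fun ω => (ω n).1) ⁻¹' S ∩ π.active n)).toReal
        ≤ (C * π.pulls p B S).toReal := by
      rw [← ENNReal.toReal_sum fun n _ => ENNReal.mul_ne_top hC (measure_ne_top _ _)]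
      refine ENNReal.toReal_mono (ENNReal.mul_ne_top hC hSfin) ?_
      rw [← Finset.mul_sum, pulls_apply _ _ _ hS]
      gcongr
      exact ENNReal.sum_le_tsum _
    have s1 := π.sum_stopReturning_add_active (π.gameLaw p B) hR N
    have s2 := π.sum_stopReturning_add_active (π.gameLaw p B') hR N
    have s3 := π.sum_measureReal_stopReturning_le (π.gameLaw p B) hR.compl h0.le hB N
    have s4 := π.sum_measureReal_stopReturning_le (π.gameLaw p B') hR h0.le hB' N
    simp only [Finset.sum_add_distrib, Finset.sum_sub_distrib, ← Finset.mul_sum] at k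
    rw [het, hent] at k
    rw [hent] at hlast
    generalize ∑ n ∈ Finset.range N, (π.gameLaw p B).real (π.stopReturning R n) = x at *
    generalize ∑ n ∈ Finset.range N, (π.gameLaw p B).real (π.stopReturning Rᶜ n) = y at *
    generalize ∑ n ∈ Finset.range N, (π.gameLaw p B').real (π.stopReturning R n) = x' at *
    generalize ∑ n ∈ Finset.range N, (π.gameLaw p B').real (π.stopReturning Rᶜ n) = y' at *
    generalize (π.gameLaw p B).real (π.active N) = z at *
    generalize (π.gameLaw p B').real (π.active N) = z' at *
    -- the masses under the law of the model `B'` contribute a nonnegative amount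
    have hx' : 0 ≤ (1 - 2 * δ) / (1 - δ) * (1 - x') - (1 - 2 * δ) / δ * x' := by
      have : (1 - 2 * δ) / (1 - δ) * (1 - x') - (1 - 2 * δ) / δ * x'
          = (1 - 2 * δ) / ((1 - δ) * δ) * (δ - x') := by field_simp; ring
      rw [this]
      exact mul_nonneg (div_nonneg (by linarith) (by positivity)) (by linarith)
    have hyz : y' + z' = 1 - x' := by linarith
    have hyz' : (1 - 2 * δ) / (1 - δ) * y' + (1 - 2 * δ) / (1 - δ) * z'
        = (1 - 2 * δ) / (1 - δ) * (1 - x') := by rw [← mul_add, hyz]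
    have hx : t * (1 - 2 * δ - 2 * z) ≤ t * (x - y - z) :=
      mul_le_mul_of_nonneg_left (by linarith) ht0
    linarith
  have hlim : Tendsto (fun N => t * (1 - 2 * δ - 2 * (π.gameLaw p B).real (π.active N))) atTop
      (𝓝 (t * (1 - 2 * δ - 2 * 0))) :=
    (((π.tendsto_active p B hfin).const_mul 2).const_sub (1 - 2 * δ)).const_mul t
  have h2 := le_of_tendsto' hlim key
  refine ENNReal.ofReal_le_of_le_toReal (le_trans (log_one_div_le_binary_kl h0 h1) ?_)
  linarith

end ChangeOfMeasure

end Policy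

end InfBandit

/-! ### Quantiles of the reservoir distribution and group boundaries -/

namespace InfBandit

open InformationTheory Filter Topology

namespace BanditModel

variable {W : Type*} [MeasurableSpace W] {Θ : Set ℝ} (B : BanditModel W Θ)

@[fun_prop]
lemma measurable_coe_mean : Measurable fun w => (B.mean w : ℝ) :=
  measurable_subtype_coe.comp B.measurable_mean

lemma measurableSet_mean_lt (x : ℝ) : MeasurableSet {w | (B.mean w : ℝ) < x} :=
  measurableSet_lt B.measurable_coe_mean measurable_const

lemma measurableSet_le_mean (x : ℝ) : MeasurableSet {w | x ≤ (B.mean w : ℝ)} :=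
  measurableSet_le measurable_const B.measurable_coe_mean

lemma G_eq_cdf (x : ℝ) : B.G x = cdf (B.M.map fun w => (B.mean w : ℝ)) x := by
  have := Measure.isProbabilityMeasure_map (μ := B.M) B.measurable_coe_mean.aemeasurable
  rw [cdf_eq_real, map_measureReal_apply B.measurable_coe_mean measurableSet_Iic]
  rfl

lemma G_mono : Monotone B.G := fun x y h => by
  rw [G_eq_cdf, G_eq_cdf]; exact monotone_cdf _ h

lemma exists_le_G {q : ℝ} (hq : q < 1) : ∃ x, q ≤ B.G x := by
  have h := tendsto_cdf_atTop (B.M.map fun w => (B.mean w : ℝ))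
  obtain ⟨x, hx⟩ := (h.eventually (lt_mem_nhds hq)).exists
  exact ⟨x, by rw [G_eq_cdf]; exact hx.le⟩

lemma bddBelow_le_G {q : ℝ} (hq : 0 < q) : BddBelow {x | q ≤ B.G x} := by
  have h := tendsto_cdf_atBot (B.M.map fun w => (B.mean w : ℝ))
  obtain ⟨x, hx⟩ := (h.eventually (gt_mem_nhds hq)).exists
  refine ⟨x, fun y hy => ?_⟩
  by_contra hlt
  have h1 := B.G_mono (not_le.1 hlt).le
  rw [G_eq_cdf _ x] at h1
  exact absurd (hy.trans h1) (not_le.2 hx)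

lemma le_G_quantile {q : ℝ} (hq : q < 1) : q ≤ B.G (B.quantile q) := by
  have h1 := (cdf (B.M.map fun w => (B.mean w : ℝ))).right_continuous (B.quantile q)
  have h2 : Tendsto B.G (𝓝[>] (B.quantile q)) (𝓝 (B.G (B.quantile q))) := by
    have : B.G = cdf (B.M.map fun w => (B.mean w : ℝ)) := funext B.G_eq_cdf
    rw [this]
    exact h1.mono_left (nhdsWithin_mono _ Set.Ioi_subset_Ici_self)
  refine ge_of_tendsto h2 ?_
  filter_upwards [self_mem_nhdsWithin] with y hy
  obtain ⟨z, hz, hzy⟩ := exists_lt_of_csInf_lt (B.exists_le_G hq) hy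
  exact le_trans hz (B.G_mono hzy.le)

lemma G_lt_of_lt_quantile {q x : ℝ} (hq : 0 < q) (hx : x < B.quantile q) : B.G x < q := by
  by_contra h
  exact absurd (csInf_le (B.bddBelow_le_G hq) (not_lt.1 h)) (not_le.2 hx)

lemma le_quantile {q y : ℝ} (hq : q < 1) (h : ∀ z < y, B.G z < q) : y ≤ B.quantile q := by
  refine le_csInf (B.exists_le_G hq) fun z hz => ?_
  by_contra hlt
  exact absurd (h z (not_le.1 hlt)) (not_lt.2 hz)

lemma measureReal_mean_lt_quantile_le {q : ℝ} (hq : 0 < q) :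
    B.M.real {w | (B.mean w : ℝ) < B.quantile q} ≤ q := by
  obtain ⟨u, hu, hlt, hlim⟩ := exists_seq_strictMono_tendsto (B.quantile q)
  have hU : {w | (B.mean w : ℝ) < B.quantile q} = ⋃ n, {w | (B.mean w : ℝ) ≤ u n} := by
    ext w
    simp only [Set.mem_ofPred_eq, Set.mem_iUnion]
    constructor
    · intro hw
      obtain ⟨n, hn⟩ := (hlim.eventually (lt_mem_nhds hw)).exists
      exact ⟨n, hn.le⟩
    · rintro ⟨n, hn⟩
      exact hn.trans_lt (hlt n)
  have ht := tendsto_measure_iUnion_atTop (μ := B.M) (s := fun n => {w | (B.mean w : ℝ) ≤ u n})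
    (fun m n hmn w hw => le_trans hw (hu.monotone hmn))
  rw [hU]
  refine le_of_tendsto' ((ENNReal.tendsto_toReal (measure_ne_top _ _)).comp ht) fun n => ?_
  exact (B.G_lt_of_lt_quantile hq (hlt n)).le

lemma measureReal_mean_lt_eq {x : ℝ} (hx : B.M {w | (B.mean w : ℝ) = x} = 0) :
    B.M.real {w | (B.mean w : ℝ) < x} = B.G x := by
  refine measureReal_congr ?_
  have : ∀ᵐ w ∂B.M, (B.mean w : ℝ) ≠ x := by
    rw [ae_iff]; simpa using hx
  filter_upwards [this] with w hw
  exact propext ⟨fun h => le_of_lt h, fun h => lt_of_le_of_ne h hw⟩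

lemma G_quantile {q : ℝ} (hq0 : 0 < q) (hq1 : q < 1)
    (h : B.M {w | (B.mean w : ℝ) = B.quantile q} = 0) : B.G (B.quantile q) = q :=
  le_antisymm (by rw [← B.measureReal_mean_lt_eq h]; exact B.measureReal_mean_lt_quantile_le hq0)
    (B.le_G_quantile hq1)

lemma G_muStar (hmax : ∀ w, (B.mean w : ℝ) ≤ B.muStar) : B.G B.muStar = 1 := by
  have : {w | (B.mean w : ℝ) ≤ B.muStar} = Set.univ := Set.eq_univ_of_forall hmax
  rw [G, this, probReal_univ]

lemma good_eq (α : ℝ) (hmax : ∀ w, (B.mean w : ℝ) ≤ B.muStar) :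
    B.good α = {w | B.b α 1 ≤ (B.mean w : ℝ)} := by
  rw [good, b, b, B.G_muStar hmax]

section Groups

variable {B} {α : ℝ} (hα0 : 0 < α) (hmax : ∀ w, (B.mean w : ℝ) ≤ B.muStar)
  (hb : ∀ i : ℕ, 1 ≤ i → i ≤ ⌈1 / α⌉₊ - 1 → B.M {w | (B.mean w : ℝ) = B.b α i} = 0)
include hα0

lemma mul_lt_one_of_le {i : ℕ} (h1 : 1 ≤ i) (hi : i ≤ ⌈1 / α⌉₊ - 1) : i * α < 1 := by
  have : (i : ℝ) < 1 / α := Nat.lt_ceil.1 (by omega)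
  rwa [lt_div_iff₀ hα0] at this

include hmax hb

/-- The groups have mass exactly `α`. -/
lemma G_b {i : ℕ} (hi : i ≤ ⌈1 / α⌉₊ - 1) : B.G (B.b α i) = 1 - i * α := by
  induction i with
  | zero => simpa [b] using B.G_muStar hmax
  | succ i ih =>
    have h1 := mul_lt_one_of_le hα0 (by omega) hi
    have h2 := hb (i + 1) (by omega) hi
    have h3 := ih (by omega)
    have hi0 : (0 : ℝ) ≤ i * α := by positivity
    push_cast at h1 ⊢
    rw [b, h3] at h2 ⊢
    rw [B.G_quantile (by linarith) (by linarith) h2]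
    ring

lemma b_lt_b {i j : ℕ} (hij : i < j) (hj : j ≤ ⌈1 / α⌉₊ - 1) : B.b α j < B.b α i := by
  by_contra h
  have h1 := B.G_mono (not_lt.1 h)
  rw [G_b hα0 hmax hb hj, G_b hα0 hmax hb (by omega)] at h1
  have : (i : ℝ) < j := by exact_mod_cast hij
  nlinarith

lemma b_le_b {i j : ℕ} (hij : i ≤ j) (hj : j ≤ ⌈1 / α⌉₊ - 1) : B.b α j ≤ B.b α i := by
  rcases hij.eq_or_lt with rfl | h
  exacts [le_rfl, (b_lt_b hα0 hmax hb h hj).le]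

lemma G_lt_of_lt_b {i : ℕ} (h1 : 1 ≤ i) (hi : i ≤ ⌈1 / α⌉₊ - 1) {x : ℝ} (hx : x < B.b α i) :
    B.G x < 1 - i * α := by
  obtain ⟨i, rfl⟩ := Nat.exists_eq_succ_of_ne_zero (by omega : i ≠ 0)
  have h2 := mul_lt_one_of_le hα0 h1 hi
  have h3 := G_b hα0 hmax hb (show i ≤ _ by omega)
  have e : 1 - i * α - α = 1 - ((i + 1 : ℕ) : ℝ) * α := by push_cast; ring
  rw [Nat.succ_eq_add_one, b, h3, e] at hx
  exact B.G_lt_of_lt_quantile (by linarith) hx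

lemma exists_mean_lt_b {i : ℕ} (h1 : 1 ≤ i) (hi : i ≤ ⌈1 / α⌉₊ - 1) :
    ∃ w, (B.mean w : ℝ) < B.b α i := by
  by_contra h
  have h2 : {w | (B.mean w : ℝ) < B.b α i} = ∅ :=
    Set.eq_empty_of_forall_notMem fun w hw => h ⟨w, hw⟩
  have h3 := B.measureReal_mean_lt_eq (hb i h1 hi)
  rw [h2, G_b hα0 hmax hb hi, measureReal_empty] at h3
  linarith [mul_lt_one_of_le hα0 h1 hi]

lemma measureReal_good (h1 : 1 ≤ ⌈1 / α⌉₊ - 1) : B.M.real (B.good α) = α := by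
  have h2 : B.good α = {w | (B.mean w : ℝ) < B.b α 1}ᶜ := by
    rw [B.good_eq α hmax]; ext w; simp
  rw [h2, probReal_compl_eq_one_sub (B.measurableSet_mean_lt _),
    B.measureReal_mean_lt_eq (hb 1 le_rfl h1), G_b hα0 hmax hb h1]
  simp

end Groups

/-! ### Alternative models -/

/-- The model obtained from `B` by giving the mean `θ` to all the arms of `S`. -/
noncomputable def modify {S : Set W} (hS : MeasurableSet S) (θ : Θ) : BanditModel W Θ where
  M := B.M
  isProb := B.isProb
  mean := open scoped Classical in fun w => if w ∈ S then θ else B.mean w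
  measurable_mean := by
    classical
    exact Measurable.ite hS measurable_const B.measurable_mean
  bounded := by
    obtain ⟨a, b, h⟩ := B.bounded
    refine ⟨min a θ, max b θ, ?_⟩
    filter_upwards [h] with w hw
    by_cases hwS : w ∈ S
    · simp [hwS]
    · simp [hwS, hw.1, hw.2]

variable {B}

lemma modify_mean_of_mem {S : Set W} (hS : MeasurableSet S) (θ : Θ) {w : W} (hw : w ∈ S) :
    (B.modify hS θ).mean w = θ := by simp [modify, hw]

lemma modify_mean_of_notMem {S : Set W} (hS : MeasurableSet S) (θ : Θ) {w : W} (hw : w ∉ S) :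
    (B.modify hS θ).mean w = B.mean w := by simp [modify, hw]

/-- If a set of arms of mass more than `α` becomes better than all the other arms, then it contains
the top-`α` fraction. -/
lemma good_modify_subset {α : ℝ} (hα0 : 0 < α) (hmax : ∀ w, (B.mean w : ℝ) ≤ B.muStar) {S : Set W}
    (hS : MeasurableSet S) (hSα : α < B.M.real S) (θ : Θ) (hθ : B.muStar < θ) :
    (B.modify hS θ).good α ⊆ S := by
  have hq : (θ : ℝ) ≤ (B.modify hS θ).quantile (1 - α) := by
    refine le_quantile _ (by linarith) fun z hz => ?_
    have h1 : (B.modify hS θ).G z ≤ B.M.real Sᶜ := by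
      refine measureReal_mono (μ := B.M) fun w hw hwS => ?_
      have hw' : ((B.modify hS θ).mean w : ℝ) ≤ z := hw
      rw [modify_mean_of_mem hS θ hwS] at hw'
      linarith
    rw [probReal_compl_eq_one_sub hS] at h1
    linarith
  intro w hw
  by_contra hwS
  have hw' : (B.modify hS θ).quantile (1 - α) ≤ ((B.modify hS θ).mean w : ℝ) := hw
  rw [modify_mean_of_notMem hS θ hwS] at hw'
  linarith [hmax w]

/-- If the top-`α` fraction becomes worse than the arms of the second group, then it becomes
disjoint from the new top-`α` fraction. -/
lemma disjoint_good_modify {α : ℝ} (hα0 : 0 < α) (hmax : ∀ w, (B.mean w : ℝ) ≤ B.muStar)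
    (hb : ∀ i : ℕ, 1 ≤ i → i ≤ ⌈1 / α⌉₊ - 1 → B.M {w | (B.mean w : ℝ) = B.b α i} = 0)
    (h2 : 2 ≤ ⌈1 / α⌉₊ - 1) (hS : MeasurableSet (B.good α)) (θ : Θ) (hθ : (θ : ℝ) < B.b α 2) :
    Disjoint (B.good α) ((B.modify hS θ).good α) := by
  have hq : B.b α 2 ≤ (B.modify hS θ).quantile (1 - α) := by
    refine le_quantile _ (by linarith) fun z hz => ?_
    have h1 : (B.modify hS θ).G z ≤ B.M.real (B.good α ∪ {w | (B.mean w : ℝ) ≤ z}) := by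
      refine measureReal_mono (μ := B.M) fun w hw => ?_
      by_cases hwS : w ∈ B.good α
      · exact Or.inl hwS
      · have hw' : ((B.modify hS θ).mean w : ℝ) ≤ z := hw
        rw [modify_mean_of_notMem hS θ hwS] at hw'
        exact Or.inr hw'
    have h3 := measureReal_union_le (μ := B.M) (B.good α) {w | (B.mean w : ℝ) ≤ z}
    have h4 := measureReal_good hα0 hmax hb (by omega)
    have h5 : B.M.real {w | (B.mean w : ℝ) ≤ z} < 1 - (2 : ℕ) * α :=
      G_lt_of_lt_b hα0 hmax hb (by omega) h2 hz
    push_cast at h5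
    linarith
  refine Set.disjoint_left.2 fun w hw hw' => ?_
  have h3 : (B.modify hS θ).quantile (1 - α) ≤ ((B.modify hS θ).mean w : ℝ) := hw'
  rw [modify_mean_of_mem hS θ hw] at h3
  linarith

end BanditModel

end InfBandit

/-! ### The number of pulls of each group -/

namespace InfBandit

open InformationTheory Filter Topology

section LowerBound

variable {W : Type*} [MeasurableSpace W] {Θ : Set ℝ} {p : RewardFamily Θ} {α δ : ℝ}
  {A : Algorithm W} {B : BanditModel W Θ}

lemma klDiv_rewardKernel (p : RewardFamily Θ) (B B' : BanditModel W Θ) (w : W) :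
    klDiv (Policy.rewardKernel p B w) (Policy.rewardKernel p B' w)
      = p.d (B.mean w) (B'.mean w) := by
  simp [RewardFamily.d, Policy.rewardKernel, Kernel.comap_apply]

lemma RewardFamily.Regular.tendsto_d (hp : p.Regular) {x y : ℝ} {u v : ℕ → ℝ} (hx : x ∈ Θ)
    (hy : y ∈ Θ) (hu : ∀ n, u n ∈ Θ) (hv : ∀ n, v n ∈ Θ) (hux : Tendsto u atTop (𝓝 x))
    (hvy : Tendsto v atTop (𝓝 y)) : Tendsto (fun n => p.d (u n) (v n)) atTop (𝓝 (p.d x y)) := by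
  have h : Tendsto (fun n => ((⟨u n, hu n⟩, ⟨v n, hv n⟩) : Θ × Θ)) atTop
      (𝓝 (⟨x, hx⟩, ⟨y, hy⟩)) :=
    (tendsto_subtype_rng.2 hux).prodMk_nhds (tendsto_subtype_rng.2 hvy)
  exact (hp.continuous_d.tendsto (⟨x, hx⟩, ⟨y, hy⟩)).comp h

/-- If moving the means of the arms of `S` to `θ` makes the top-`α` fractions of the two models
disjoint, then a correct algorithm must pull the arms of `S` often. -/
lemma ofReal_log_le_mul_pulls_of_disjoint (hA : A.IsCorrect p α δ) (h0 : 0 < δ) (h1 : δ < 5 / 12)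
    (hfin : (A B.M).pulls p B Set.univ ≠ ⊤) {S : Set W} (hS : MeasurableSet S) (θ : Θ) {C : ℝ≥0∞}
    (hC : C ≠ ⊤) (hSC : ∀ w ∈ S, p.d (B.mean w) θ ≤ C)
    (hdisj : Disjoint (B.good α) ((B.modify hS θ).good α)) :
    ENNReal.ofReal (Real.log (1 / (2.4 * δ))) ≤ C * (A B.M).pulls p B S := by
  have hB' : (A B.M).gameLaw p (B.modify hS θ) {ω | ∃ n, (A B.M).StopsAt n ω ∧
      (A B.M).returned n ω ∉ (B.modify hS θ).good α} ≤ ENNReal.ofReal δ := hA (B.modify hS θ)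
  refine (A B.M).ofReal_log_le_mul_pulls (B' := B.modify hS θ) p hS hC ?_ ?_
    (B.measurableSet_le_mean (B.quantile (1 - α))) h0 h1 (hA B) ?_ hfin
  · intro w hw
    rw [klDiv_rewardKernel, BanditModel.modify_mean_of_mem hS θ hw]
    exact hSC w hw
  · intro w hw
    simp [Policy.rewardKernel, Kernel.comap_apply, BanditModel.modify_mean_of_notMem hS θ hw]
  · refine (measure_mono ?_).trans hB'
    rintro ω ⟨n, hn, hR⟩
    exact ⟨n, hn, Set.disjoint_left.1 hdisj hR⟩

lemma mem_of_mean_le_of_le (hΘ : Θ.OrdConnected) {w : W} {θ x : ℝ} (hθ : θ ∈ Θ)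
    (hwx : (B.mean w : ℝ) ≤ x) (hxθ : x ≤ θ) : x ∈ Θ :=
  hΘ.out (B.mean w).2 hθ ⟨hwx, hxθ⟩

variable (hΘ : Θ.OrdConnected) (hp : p.Regular) (hα0 : 0 < α) (hA : A.IsCorrect p α δ)
  (hmax : ∀ w, (B.mean w : ℝ) ≤ B.muStar) (hsup : ∃ θ ∈ Θ, B.muStar < θ)
  (hb : ∀ i : ℕ, 1 ≤ i → i ≤ ⌈1 / α⌉₊ - 1 → B.M {w | (B.mean w : ℝ) = B.b α i} = 0)
  (h0 : 0 < δ) (h1 : δ < 5 / 12) (hfin : (A B.M).pulls p B Set.univ ≠ ⊤)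
include hΘ hp hα0 hA hmax hsup hb h0 h1 hfin

/-- The best group: its arms are compared with arms slightly worse than those of the second
group. -/
lemma ofReal_log_le_mul_pulls_good (h2 : 2 ≤ ⌈1 / α⌉₊ - 1) :
    ENNReal.ofReal (Real.log (1 / (2.4 * δ)))
      ≤ p.d B.muStar (B.b α 2) * (A B.M).pulls p B {w | B.b α 1 ≤ (B.mean w : ℝ)} := by
  obtain ⟨θ, hθ, hμθ⟩ := hsup
  obtain ⟨w, hw⟩ := BanditModel.exists_mean_lt_b hα0 hmax hb (by omega) h2
  have hlt : B.b α 2 < B.muStar := BanditModel.b_lt_b hα0 hmax hb (i := 0) (by omega) h2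
  have hμ : B.muStar ∈ Θ := mem_of_mean_le_of_le hΘ hθ (hmax w) hμθ.le
  have hb2 : B.b α 2 ∈ Θ := mem_of_mean_le_of_le hΘ hμ hw.le hlt.le
  obtain ⟨u, -, hu, hulim⟩ := exists_seq_strictMono_tendsto' hw
  have huΘ : ∀ n, u n ∈ Θ := fun n => mem_of_mean_le_of_le hΘ hb2 (hu n).1.le (hu n).2.le
  have hlim := hp.tendsto_d hμ hb2 (fun _ => hμ) huΘ tendsto_const_nhds hulim
  have hpulls : (A B.M).pulls p B {w | B.b α 1 ≤ (B.mean w : ℝ)} ≠ ⊤ :=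
    ne_top_of_le_ne_top hfin (measure_mono (Set.subset_univ _))
  refine ge_of_tendsto' (ENNReal.Tendsto.mul_const hlim (Or.inr hpulls)) fun n => ?_
  have hun : u n < B.muStar := (hu n).2.trans hlt
  rw [← B.good_eq α hmax]
  have hS : MeasurableSet (B.good α) := B.measurableSet_le_mean (B.quantile (1 - α))
  refine ofReal_log_le_mul_pulls_of_disjoint hA h0 h1 hfin hS ⟨u n, huΘ n⟩
    (hp.d_lt_top _ hμ _ (huΘ n) hun.ne').ne (fun w' hw' => ?_)
    (BanditModel.disjoint_good_modify hα0 hmax hb h2 hS _ (hu n).2)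
  rw [B.good_eq α hmax] at hw'
  have h12 : B.b α 2 < B.b α 1 := BanditModel.b_lt_b hα0 hmax hb (by omega) h2
  rcases (hmax w').eq_or_lt with h | h
  · rw [h]
  · exact hp.d_left_above _ (huΘ n) _ (B.mean w').2 _ hμ
      ((hu n).2.trans (h12.trans_le hw')) h

/-- The other groups: their arms are compared with arms slightly better than all the arms. -/
lemma ofReal_log_le_mul_pulls_group {i : ℕ} (hi : 2 ≤ i) (hi' : i ≤ ⌈1 / α⌉₊ - 1) :
    ENNReal.ofReal (Real.log (1 / (2.4 * δ)))
      ≤ p.d (B.b α i) B.muStar *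
        (A B.M).pulls p B {w | B.b α i ≤ (B.mean w : ℝ) ∧ (B.mean w : ℝ) < B.b α (i - 1)} := by
  obtain ⟨θ, hθ, hμθ⟩ := hsup
  obtain ⟨w, hw⟩ := BanditModel.exists_mean_lt_b hα0 hmax hb (by omega) hi'
  have hlt : B.b α i < B.muStar := BanditModel.b_lt_b hα0 hmax hb (i := 0) (by omega) hi'
  have hμ : B.muStar ∈ Θ := mem_of_mean_le_of_le hΘ hθ (hmax w) hμθ.le
  have hbi : B.b α i ∈ Θ := mem_of_mean_le_of_le hΘ hμ hw.le hlt.le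
  -- Arms with mean exactly `muStar` stay in the top-`α` fraction as long as the mass of the arms
  -- that overtake them is only `α`, so that the group has to be slightly enlarged downwards.
  obtain ⟨u, hu_mono, hu, hulim⟩ := exists_seq_strictMono_tendsto' hw
  obtain ⟨v, -, hv, hvlim⟩ := exists_seq_strictAnti_tendsto' hμθ
  have huΘ : ∀ n, u n ∈ Θ := fun n => mem_of_mean_le_of_le hΘ hbi (hu n).1.le (hu n).2.le
  have hvΘ : ∀ n, v n ∈ Θ := fun n => hΘ.out hμ hθ ⟨(hv n).1.le, (hv n).2.le⟩
  set S : ℕ → Set W := fun n =>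
    {w | u n ≤ (B.mean w : ℝ) ∧ (B.mean w : ℝ) < B.b α (i - 1)} with hSdef
  have hS : ∀ n, MeasurableSet (S n) := fun n =>
    (B.measurableSet_le_mean _).inter (B.measurableSet_mean_lt _)
  have hInter : {w | B.b α i ≤ (B.mean w : ℝ) ∧ (B.mean w : ℝ) < B.b α (i - 1)} = ⋂ n, S n := by
    ext w'
    simp only [hSdef, Set.mem_ofPred_eq, Set.mem_iInter]
    exact ⟨fun h n => ⟨(hu n).2.le.trans h.1, h.2⟩,
      fun h => ⟨le_of_tendsto' hulim fun n => (h n).1, (h 0).2⟩⟩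
  have hSlim : Tendsto (fun n => (A B.M).pulls p B (S n)) atTop
      (𝓝 ((A B.M).pulls p B (⋂ n, S n))) :=
    tendsto_measure_iInter_atTop (fun n => (hS n).nullMeasurableSet)
      (fun m n hmn w' hw' => ⟨(hu_mono.monotone hmn).trans hw'.1, hw'.2⟩)
      ⟨0, ne_top_of_le_ne_top hfin (measure_mono (Set.subset_univ _))⟩
  have hlim := hp.tendsto_d hbi hμ huΘ hvΘ hulim hvlim
  rw [hInter]
  refine ge_of_tendsto' (ENNReal.Tendsto.mul hlim
    (Or.inl (hp.d_pos _ hbi _ hμ hlt.ne).ne') hSlim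
    (Or.inr (hp.d_lt_top _ hbi _ hμ hlt.ne).ne)) fun n => ?_
  have hun : u n < v n := (hu n).2.trans (hlt.trans (hv n).1)
  refine ofReal_log_le_mul_pulls_of_disjoint hA h0 h1 hfin (hS n) ⟨v n, hvΘ n⟩
    (hp.d_lt_top _ (huΘ n) _ (hvΘ n) hun.ne).ne (fun w' hw' => ?_) ?_
  · rcases hw'.1.eq_or_lt with h | h
    · rw [h]
    · exact (hp.d_left_below _ (huΘ n) _ (B.mean w').2 _ (hvΘ n) h
        ((hmax w').trans_lt (hv n).1)).le
  · have hmass : α < B.M.real (S n) := by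
      have e : S n = {w | (B.mean w : ℝ) < B.b α (i - 1)} \ {w | (B.mean w : ℝ) < u n} := by
        ext w'; simp [hSdef, and_comm]
      have e1 := measureReal_mono (μ := B.M) (s₁ := {w | (B.mean w : ℝ) < u n})
        (s₂ := {w | (B.mean w : ℝ) ≤ u n})
        (fun w' hw' => show (B.mean w' : ℝ) ≤ u n from le_of_lt hw')
      have e2 : B.M.real {w | (B.mean w : ℝ) ≤ u n} < 1 - i * α :=
        BanditModel.G_lt_of_lt_b hα0 hmax hb (by omega) hi' (hu n).2
      have e3 := le_measureReal_sdiff (μ := B.M) (s₁ := {w | (B.mean w : ℝ) < B.b α (i - 1)})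
        (s₂ := {w | (B.mean w : ℝ) < u n})
      rw [← e, B.measureReal_mean_lt_eq (hb (i - 1) (by omega) (by omega)),
        BanditModel.G_b hα0 hmax hb (show i - 1 ≤ _ by omega), Nat.cast_sub (by omega)] at e3
      push_cast at e3
      linarith
    refine Set.disjoint_left.2 fun w' hw' hw'' => ?_
    have h3 := (BanditModel.good_modify_subset hα0 hmax (hS n) hmass ⟨v n, hvΘ n⟩ (hv n).1 hw'').2
    rw [B.good_eq α hmax] at hw'
    exact absurd (h3.trans_le (BanditModel.b_le_b hα0 hmax hb (i := 1) (by omega)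
      (show i - 1 ≤ _ by omega))) (not_lt.2 hw')

end LowerBound

/-- The groups are disjoint. -/
lemma BanditModel.add_sum_groups_le {W : Type*} [MeasurableSpace W] {Θ : Set ℝ}
    (B : BanditModel W Θ) (ν : Measure W) {b : ℕ → ℝ} {n : ℕ} (hn : 1 ≤ n)
    (hb : ∀ i, 2 ≤ i → i ≤ n → b i ≤ b (i - 1)) :
    ν {w | b 1 ≤ (B.mean w : ℝ)}
      + ∑ i ∈ Finset.Icc 2 n, ν {w | b i ≤ (B.mean w : ℝ) ∧ (B.mean w : ℝ) < b (i - 1)}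
      ≤ ν {w | b n ≤ (B.mean w : ℝ)} := by
  induction n, hn using Nat.le_induction with
  | base => simp
  | succ n hn ih =>
    rw [Finset.sum_Icc_succ_top (by omega), ← add_assoc]
    refine (add_le_add_left (ih fun i h2 hi => hb i h2 (by omega)) _).trans ?_
    have hle := hb (n + 1) (by omega) le_rfl
    rw [Nat.add_sub_cancel] at hle ⊢
    rw [← measure_union]
    · refine measure_mono fun w hw => ?_
      rcases hw with hw | hw
      exacts [hle.trans hw, hw.1]
    · exact Set.disjoint_left.2 fun w hw hw' => absurd hw'.2 (not_lt.2 hw)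
    · exact (B.measurableSet_le_mean _).inter (B.measurableSet_mean_lt _)

end InfBandit

theorem theorem1 {W : Type*} [MeasurableSpace W] {Θ : Set ℝ} (hΘ : Θ.OrdConnected)
    (p : InfBandit.RewardFamily Θ) (hp : p.Regular)
    (α δ : ℝ) (hα0 : 0 < α) (hα : α < 1 / 2) (hδ0 : 0 < δ) (hδ1 : δ < 1)
    (A : InfBandit.Algorithm W) (hA : InfBandit.Algorithm.IsCorrect A p α δ)
    (B : InfBandit.BanditModel W Θ)
    (hmax : ∀ w, (B.mean w : ℝ) ≤ B.muStar)
    (hsup : ∃ θ ∈ Θ, B.muStar < θ)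
    (hb : ∀ i : ℕ, 1 ≤ i → i ≤ ⌈1 / α⌉₊ - 1 → B.M {w | (B.mean w : ℝ) = B.b α i} = 0) :
    (1 / p.d B.muStar (B.b α 2)
        + ∑ i ∈ Finset.Icc 2 (⌈1 / α⌉₊ - 1), 1 / p.d (B.b α i) B.muStar)
      * ENNReal.ofReal (Real.log (1 / (2.4 * δ)))
      ≤ (A B.M).expectedTau p B := by
  have hm : 2 ≤ ⌈1 / α⌉₊ - 1 := by
    have : 2 < ⌈1 / α⌉₊ := by
      rw [Nat.lt_ceil, lt_div_iff₀ hα0]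
      push_cast
      linarith
    omega
  rcases le_or_gt (5 / 12) δ with hδ | hδ
  · -- the logarithm is not positive
    have hlog : Real.log (1 / (2.4 * δ)) ≤ 0 := by
      refine Real.log_nonpos (by positivity) ?_
      rw [div_le_one (by positivity)]
      norm_num at hδ ⊢
      linarith
    rw [ENNReal.ofReal_of_nonpos hlog, mul_zero]
    exact zero_le
  by_cases hfin : (A B.M).pulls p B Set.univ = ⊤
  · exact le_top.trans (hfin ▸ (A B.M).pulls_univ_le p B)
  have hgood := InfBandit.ofReal_log_le_mul_pulls_good hΘ hp hα0 hA hmax hsup hb hδ0 hδ hfin hm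
  have hgroup := fun i (hi : i ∈ Finset.Icc 2 (⌈1 / α⌉₊ - 1)) =>
    InfBandit.ofReal_log_le_mul_pulls_group hΘ hp hα0 hA hmax hsup hb hδ0 hδ hfin
      (Finset.mem_Icc.1 hi).1 (Finset.mem_Icc.1 hi).2
  have hsum := B.add_sum_groups_le ((A B.M).pulls p B) (b := B.b α) (n := ⌈1 / α⌉₊ - 1)
    (by omega) fun i _ hi => InfBandit.BanditModel.b_le_b hα0 hmax hb (by omega) hi
  refine le_trans ?_ ((hsum.trans (measure_mono (Set.subset_univ _))).trans
    ((A B.M).pulls_univ_le p B))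
  rw [add_mul, Finset.sum_mul]
  refine add_le_add ?_ (Finset.sum_le_sum fun i hi => ?_)
  · rw [one_div, mul_comm, ← div_eq_mul_inv]
    exact ENNReal.div_le_of_le_mul' hgood
  · rw [one_div, mul_comm, ← div_eq_mul_inv]
    exact ENNReal.div_le_of_le_mul' (hgroup i hi)
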